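/- Let $\mathbf{F}$ be a finite field with $q$ elements and let $k$ be a field in which $q \neq 0$. For integers $n, m \ge 0$ let $\mathfrak{M}_{n,m}$ be the set of $n \times m$ matrices over $\mathbf{F}$, let $\mathfrak{M}_n = \mathfrak{M}_{n,n}$, regarded as a monoid under multiplication, and let $k[\mathfrak{M}_n]$ be its monoid algebra. Let $k[\mathfrak{M}_{n,m}]$ be the $k$-vector space with basis $\{[X] : X \in \mathfrak{M}_{n,m}\}$, with the left action of $k[\mathfrak{M}_n]$ given by $[A]\cdot[X] = [AX]$ and the right action of $k[\mathfrak{M}_m]$ given by $[X]\cdot[B] = [XB]$. Let $V = k[\mathbf{F}^n]$ be the $k$-vector space with basis $\{[v] : v \in \mathbf{F}^n\}$, and let $k[\mathfrak{M}_n]$ act on $V^{\otimes m}$ by $[A]\cdot([v_1] \otimes \cdots \otimes [v_m]) = [Av_1] \otimes \cdots \otimes [Av_m]$ for $A \in \mathfrak{M}_n$. **Theorem (Schur–Weyl duality for matrix monoids).** 1. There is an isomorphism of left $k[\mathfrak{M}_n]$-modules $V^{\otimes m} \cong k[\mathfrak{M}_{n,m}]$ that sends $[v_1] \otimes \cdots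 \otimes [v_m]$ to $[X]$, where $X$ is the matrix with columns $v_1, \dots, v_m$. 2. The images of $k[\mathfrak{M}_n]$ and $k[\mathfrak{M}_m]$ in $\mathrm{End}_k(k[\mathfrak{M}_{n,m}])$ are centralizers of each other: an endomorphism commutes with the image of $k[\mathfrak{M}_n]$ if and only if it lies in the image of $k[\mathfrak{M}_m]$, and it commutes with the image of $k[\mathfrak{M}_m]$ if and only if it lies in the image of $k[\mathfrak{M}_n]$. -/

import Mathlib

open scoped TensorProduct

noncomputable section

namespace MatrixMonoid

variable (k F : Type*) [Field k] [Field F]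

/-- The vector space `k[𝔐_{n,m}]` with basis the set of `n × m` matrices over `F`. -/
abbrev MatSpace (n m : ℕ) : Type _ := Matrix (Fin n) (Fin m) F →₀ k

/-- The vector space `V = k[F^n]` with basis the set of vectors of `F^n`. -/
abbrev VecSpace (n : ℕ) : Type _ := (Fin n → F) →₀ k

/-- The monoid algebra `k[𝔐_n]` of the multiplicative monoid of `n × n` matrices over `F`. -/
abbrev MatAlg (n : ℕ) : Type _ := MonoidAlgebra k (Matrix (Fin n) (Fin n) F)

/-- The left action of `k[𝔐_n]` on `k[𝔐_{n,m}]`, determined by `[A] • [X] = [A X]`. -/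
def leftAction (n m : ℕ) : MatAlg k F n →ₐ[k] Module.End k (MatSpace k F n m) :=
  MonoidAlgebra.lift k (Module.End k (MatSpace k F n m)) (Matrix (Fin n) (Fin n) F)
    { toFun := fun A => Finsupp.lmapDomain k k (fun X => A * X)
      map_one' := by
        ext X : 2
        simp
      map_mul' := fun A B => by
        ext X : 2
        simp [Matrix.mul_assoc] }

/-- The right action of `k[𝔐_m]` on `k[𝔐_{n,m}]`, determined by `[X] • [B] = [X B]`, as an algebra
homomorphism from the opposite algebra of `k[𝔐_m]` to the endomorphism algebra. -/
def rightAction (n m : ℕ) : (MatAlg k F m)ᵐᵒᵖ →ₐ[k] Module.End k (MatSpace k F n m) :=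
  AlgHom.opComm <|
    MonoidAlgebra.lift k (Module.End k (MatSpace k F n m))ᵐᵒᵖ (Matrix (Fin m) (Fin m) F)
      { toFun := fun B => MulOpposite.op (Finsupp.lmapDomain k k (fun X => X * B))
        map_one' := by
          apply MulOpposite.unop_injective
          ext X : 2
          simp
        map_mul' := fun A B => by
          apply MulOpposite.unop_injective
          ext X : 2
          simp [Matrix.mul_assoc] }

/-- The action of `k[𝔐_n]` on `V^{⊗ m}`, `V = k[F^n]`, determined by
`[A] • ([v_1] ⊗ ⋯ ⊗ [v_m]) = [A v_1] ⊗ ⋯ ⊗ [A v_m]`. -/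
def tensorAction (n m : ℕ) :
    MatAlg k F n →ₐ[k] Module.End k (⨂[k] _ : Fin m, VecSpace k F n) :=
  MonoidAlgebra.lift k (Module.End k (⨂[k] _ : Fin m, VecSpace k F n))
    (Matrix (Fin n) (Fin n) F)
    { toFun := fun A =>
        PiTensorProduct.map fun _ => Finsupp.lmapDomain k k (fun v => A.mulVec v)
      map_one' := by
        have h : (Finsupp.lmapDomain k k (fun v : Fin n → F => (1 : Matrix _ _ F).mulVec v)) =
            (1 : VecSpace k F n →ₗ[k] VecSpace k F n) := by
          ext v : 2
          simp
        simp only [h]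
        exact PiTensorProduct.map_one
      map_mul' := fun A B => by
        have h : (Finsupp.lmapDomain k k (fun v : Fin n → F => (A * B).mulVec v)) =
            (Finsupp.lmapDomain k k (fun v : Fin n → F => A.mulVec v) :
              VecSpace k F n →ₗ[k] VecSpace k F n) *
            Finsupp.lmapDomain k k (fun v : Fin n → F => B.mulVec v) := by
          ext v : 2
          simp
        simp only [h]
        exact PiTensorProduct.map_mul _ _ }

end MatrixMonoid

end

/-! The crux is Kovács' phenomenon (`hasLeftIdentity`): the span of the `n × n` matrices of rank at
most `m` contains an `ε` acting as the identity on `k[𝔐_{n,m}]`. Such an `ε` is a combination of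
products `YZ` factoring through `F^m`. If `f` commutes with the right action, then `f(YZx) =
f(Y)Zx`, so `f(x) = f(εx)` is left multiplication by the corresponding sum of terms `f(Y)Z`
(`HasLeftIdentity.exists_eq_convMul`). Transposition gives the other centralizer.

`ε` is built by induction on the rank bound. Lower ranks are split off by a central idempotent `e`;
full-rank matrices, up to column operations, give coordinate morphisms of right modules
(`exists_coordinate`). When `k` has a primitive additive character `ψ` of `F`, the pairing
`ψ(tr(ZX))` is perfect by Fourier inversion, so these morphisms are left multiplications
(`exists_eq_convMul`) and assemble into `ε`. For general `k`, pass to a cyclotomic extension and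
descend by a `k`-linear retraction. -/

open scoped TensorProduct

noncomputable section

namespace MatrixMonoid

/-! ### Products and transposes of formal combinations of matrices -/

section Product

variable {k F : Type*} [Field k] [Field F] {n m l p : ℕ}

/-- The bilinear extension of matrix multiplication. -/
def convMul : MatSpace k F n m →ₗ[k] MatSpace k F m l →ₗ[k] MatSpace k F n l :=
  Finsupp.lsum k fun X => LinearMap.toSpanSingleton k _ (Finsupp.lmapDomain k k fun Y => X * Y)

@[simp]
theorem single_convMul_single (X : Matrix (Fin n) (Fin m) F) (Y : Matrix (Fin m) (Fin l) F)
    (a b : k) :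
    convMul (Finsupp.single X a) (Finsupp.single Y b) = Finsupp.single (X * Y) (a * b) := by
  simp [convMul]

theorem convMul_assoc (x : MatSpace k F n m) (y : MatSpace k F m l) (z : MatSpace k F l p) :
    convMul (convMul x y) z = convMul x (convMul y z) := by
  induction x using Finsupp.induction_linear with
  | zero => simp
  | add x x' hx hx' => simp [hx, hx']
  | single X a =>
    induction y using Finsupp.induction_linear with
    | zero => simp
    | add y y' hy hy' => simp [hy, hy']
    | single Y b =>
      induction z using Finsupp.induction_linear with
      | zero => simp
      | add z z' hz hz' => rw [map_add, map_add, map_add, hz, hz']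
      | single Z c => simp only [single_convMul_single, Matrix.mul_assoc, mul_assoc]

/-- The linear extension of transposition. -/
def transpose : MatSpace k F n m →ₗ[k] MatSpace k F m n :=
  Finsupp.lmapDomain k k Matrix.transpose

omit [Field F] in
@[simp]
theorem transpose_single (X : Matrix (Fin n) (Fin m) F) (a : k) :
    transpose (Finsupp.single X a) = Finsupp.single X.transpose a := by
  simp [transpose]

omit [Field F] in
@[simp]
theorem transpose_transpose (x : MatSpace k F n m) : transpose (transpose x) = x := by
  induction x using Finsupp.induction_linear with
  | zero => simp
  | add x x' hx hx' => simp [hx, hx']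
  | single X a => simp

theorem transpose_convMul (x : MatSpace k F n m) (y : MatSpace k F m l) :
    transpose (convMul x y) = convMul (transpose y) (transpose x) := by
  induction x using Finsupp.induction_linear with
  | zero => simp
  | add x x' hx hx' => simp [hx, hx']
  | single X a =>
    induction y using Finsupp.induction_linear with
    | zero => simp
    | add y y' hy hy' => simp [hy, hy']
    | single Y b =>
      simp only [single_convMul_single, transpose_single, Matrix.transpose_mul, mul_comm]

end Product

/-! ### Rank filtration and rank factorizations -/

section Rank

variable (k F : Type*) [Field k] [Field F]

/-- The span of the matrices of rank at most `r`. -/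
def rankLE (n m r : ℕ) : Submodule k (MatSpace k F n m) :=
  Finsupp.supported k k {A | A.rank ≤ r}

variable {k F} {n m l r s : ℕ}

theorem single_mem_rankLE {A : Matrix (Fin n) (Fin m) F} (hA : A.rank ≤ r) (a : k) :
    Finsupp.single A a ∈ rankLE k F n m r :=
  Finsupp.single_mem_supported k a hA

theorem rankLE_mono (h : r ≤ s) : rankLE k F n m r ≤ rankLE k F n m s :=
  Finsupp.supported_mono fun _ hA => le_trans hA h

theorem rankLE_induction {P : MatSpace k F n m → Prop}
    (single : ∀ (A : Matrix (Fin n) (Fin m) F) (a : k), A.rank ≤ r → P (Finsupp.single A a))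
    (add : ∀ x y, P x → P y → P (x + y)) {x : MatSpace k F n m} (hx : x ∈ rankLE k F n m r) :
    P x := by
  rw [← Finsupp.sum_single x, Finsupp.sum]
  refine Finset.sum_induction _ P add ?_ fun A hA => single A _ (hx hA)
  simpa using single 0 0 (by simp)

theorem convMul_mem_rankLE_of_left {x : MatSpace k F n m} (hx : x ∈ rankLE k F n m r)
    (y : MatSpace k F m l) : convMul x y ∈ rankLE k F n l r := by
  refine rankLE_induction (P := fun x => convMul x y ∈ rankLE k F n l r)
    (fun A a hA => ?_) (fun x x' hx hx' => ?_) hx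
  · induction y using Finsupp.induction_linear with
    | zero => simp
    | add y y' hy hy' => simpa using add_mem hy hy'
    | single B b =>
      rw [single_convMul_single]
      exact single_mem_rankLE ((Matrix.rank_mul_le_left A B).trans hA) _
  · simpa using add_mem hx hx'

theorem transpose_mem_rankLE {x : MatSpace k F n m} (hx : x ∈ rankLE k F n m r) :
    transpose x ∈ rankLE k F m n r := by
  refine rankLE_induction (P := fun x => transpose x ∈ rankLE k F m n r)
    (fun A a hA => ?_) (fun x x' hx hx' => ?_) hx
  · rw [transpose_single]
    exact single_mem_rankLE (by rwa [Matrix.rank_transpose]) _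
  · simpa using add_mem hx hx'

theorem convMul_mem_rankLE_of_right (x : MatSpace k F n m) {y : MatSpace k F m l}
    (hy : y ∈ rankLE k F m l r) : convMul x y ∈ rankLE k F n l r := by
  have := transpose_mem_rankLE
    (convMul_mem_rankLE_of_left (transpose_mem_rankLE hy) (transpose x))
  rwa [transpose_convMul, transpose_transpose, transpose_transpose] at this

/-- The range of `A` embeds in `F^r`; `Z` is `A` followed by the embedding, `Y` a retraction
followed by the inclusion of the range. -/
theorem exists_eq_mul_of_rank_le (A : Matrix (Fin n) (Fin m) F) (hA : A.rank ≤ r) :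
    ∃ (Y : Matrix (Fin n) (Fin r) F) (Z : Matrix (Fin r) (Fin m) F), A = Y * Z := by
  have h : Module.finrank F (LinearMap.range A.mulVecLin) ≤ Module.finrank F (Fin r → F) := by
    simpa [Matrix.rank] using hA
  obtain ⟨f, hf⟩ : ∃ f : LinearMap.range A.mulVecLin →ₗ[F] (Fin r → F),
      Function.Injective f := by
    let b := Module.finBasis F (LinearMap.range A.mulVecLin)
    have h' : Module.finrank F (LinearMap.range A.mulVecLin) ≤ r := by simpa using h
    refine ⟨(Finsupp.lcoeFun.comp (Finsupp.lmapDomain F F (Fin.castLE h'))).comp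
      b.repr.toLinearMap, ?_⟩
    exact DFunLike.coe_injective.comp
      ((Finsupp.mapDomain_injective (Fin.castLE_injective h')).comp b.repr.injective)
  obtain ⟨g, hg⟩ := f.exists_leftInverse_of_injective (LinearMap.ker_eq_bot.2 hf)
  refine ⟨LinearMap.toMatrix' ((LinearMap.range A.mulVecLin).subtype ∘ₗ g),
    LinearMap.toMatrix' (f ∘ₗ A.mulVecLin.rangeRestrict), ?_⟩
  rw [← LinearMap.toMatrix'_comp, LinearMap.comp_assoc, ← LinearMap.comp_assoc _ f g, hg,
    LinearMap.id_comp, LinearMap.subtype_comp_codRestrict]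
  exact (LinearMap.toMatrix'_toLin' A).symm

theorem isUnit_of_le_rank {B : Matrix (Fin n) (Fin n) F} (hB : n ≤ B.rank) : IsUnit B := by
  rw [← Matrix.isUnit_toLin'_iff, LinearMap.isUnit_iff_range_eq_top]
  refine Submodule.eq_top_of_finrank_eq (le_antisymm (Submodule.finrank_le _) ?_)
  rw [Module.finrank_fin_fun]
  exact hB

theorem mul_left_cancel_of_le_rank {X : Matrix (Fin n) (Fin m) F} (hX : m ≤ X.rank)
    {B C : Matrix (Fin m) (Fin l) F} (h : X * B = X * C) : B = C := by
  have hker : LinearMap.ker X.mulVecLin = ⊥ := by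
    rw [← Submodule.finrank_eq_zero (R := F)]
    have := X.mulVecLin.finrank_range_add_finrank_ker
    rw [Module.finrank_fin_fun] at this
    have : m ≤ Module.finrank F (LinearMap.range X.mulVecLin) := hX
    omega
  refine Matrix.toLin'.injective (LinearMap.ext fun v => LinearMap.ker_eq_bot.1 hker ?_)
  simp [Matrix.mulVec_mulVec, h]

end Rank

/-! ### Fourier inversion for the trace pairing -/

section Fourier

variable {k F : Type*} [Field k] [Field F] [Fintype F] {n m : ℕ}

/-- The linear functional on `k[𝔐_m]` given by `[B] ↦ ψ (tr B)`. -/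
def charTrace (ψ : AddChar F k) : MatSpace k F m m →ₗ[k] k :=
  Finsupp.linearCombination k fun B => ψ B.trace

omit [Fintype F] in
@[simp]
theorem charTrace_single (ψ : AddChar F k) (B : Matrix (Fin m) (Fin m) F) (a : k) :
    charTrace ψ (Finsupp.single B a) = a * ψ B.trace := by
  simp [charTrace]

omit [Fintype F] in
theorem charTrace_convMul_comm (ψ : AddChar F k) (x : MatSpace k F n m) (y : MatSpace k F m n) :
    charTrace ψ (convMul x y) = charTrace ψ (convMul y x) := by
  induction x using Finsupp.induction_linear with
  | zero => simp
  | add x x' hx hx' => simp [hx, hx']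
  | single X a =>
    induction y using Finsupp.induction_linear with
    | zero => simp
    | add y y' hy hy' => simp only [map_add, LinearMap.add_apply, hy, hy']
    | single Y b =>
      simp only [single_convMul_single, charTrace_single, Matrix.trace_mul_comm X Y, mul_comm a b]

omit [Field F] in
theorem card_matrix_ne_zero (hq : (Fintype.card F : k) ≠ 0) :
    (Fintype.card (Matrix (Fin m) (Fin n) F) : k) ≠ 0 := by
  have : Fintype.card (Matrix (Fin m) (Fin n) F) = (Fintype.card F ^ n) ^ m := by
    rw [← Nat.card_eq_fintype_card]
    simp [Matrix]
  rw [this]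
  push_cast
  exact pow_ne_zero _ (pow_ne_zero _ hq)

theorem sum_addChar_trace_mul {ψ : AddChar F k} (hψ : ψ.IsPrimitive)
    {D : Matrix (Fin n) (Fin m) F} (hD : D ≠ 0) :
    ∑ Z : Matrix (Fin m) (Fin n) F, ψ (Z * D).trace = 0 := by
  obtain ⟨i, j, hij⟩ : ∃ i j, D i j ≠ 0 := by
    by_contra! h
    exact hD (Matrix.ext h)
  let φ : Matrix (Fin m) (Fin n) F →+ F :=
    AddMonoidHom.mk' (fun Z => (Z * D).trace) fun Z Z' => by rw [Matrix.add_mul, Matrix.trace_add]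
  classical
  refine (AddChar.sum_eq_ite (ψ.compAddMonoidHom φ)).trans (if_neg fun h => ?_)
  obtain ⟨a, ha⟩ := AddChar.ne_one_iff.1 (hψ one_ne_zero)
  rw [AddChar.mulShift_one] at ha
  refine ha ?_
  -- This multiple of a matrix unit makes `tr(ZD) = a`, where `ψ a ≠ 1`.
  have h1 := DFunLike.congr_fun h (Matrix.single j i (a / D i j))
  simpa [φ, Matrix.trace_single_mul, div_mul_cancel₀ a hij] using h1

theorem exists_charTrace_eq {ψ : AddChar F k} (hψ : ψ.IsPrimitive)
    (hq : (Fintype.card F : k) ≠ 0) (f : MatSpace k F n m →ₗ[k] k) :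
    ∃ q : MatSpace k F m n, ∀ x, charTrace ψ (convMul q x) = f x := by
  classical
  set N : k := (Fintype.card (Matrix (Fin m) (Fin n) F) : k) with hN
  have hN0 : N ≠ 0 := card_matrix_ne_zero hq
  -- The coefficients are the normalized Fourier transform of `f`; orthogonality of characters
  -- recovers `f`.
  refine ⟨∑ Z, Finsupp.single Z (N⁻¹ * ∑ X, f (Finsupp.single X 1) * ψ (-(Z * X).trace)),
    fun x => ?_⟩
  induction x using Finsupp.induction_linear with
  | zero => simp
  | add x x' hx hx' => rw [map_add, map_add, hx, hx', map_add]
  | single W a =>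
    have hW : f (Finsupp.single W a) = a * f (Finsupp.single W 1) := by
      rw [← smul_eq_mul, ← map_smul, Finsupp.smul_single, smul_eq_mul, mul_one]
    simp only [map_sum, LinearMap.sum_apply, single_convMul_single, charTrace_single]
    have key : ∀ X : Matrix (Fin n) (Fin m) F,
        ∑ Z : Matrix (Fin m) (Fin n) F, ψ (-(Z * X).trace) * ψ (Z * W).trace =
          if X = W then N else 0 := by
      intro X
      simp only [← AddChar.map_add_eq_mul]
      have : ∀ Z : Matrix (Fin m) (Fin n) F,
          -(Z * X).trace + (Z * W).trace = (Z * (W - X)).trace := fun Z => by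
        rw [Matrix.mul_sub, Matrix.trace_sub]; ring
      simp only [this]
      split_ifs with h
      · simp [h, hN]
      · exact sum_addChar_trace_mul hψ (sub_ne_zero.2 (Ne.symm h))
    calc _ = N⁻¹ * a * ∑ X, f (Finsupp.single X 1) *
          ∑ Z : Matrix (Fin m) (Fin n) F, ψ (-(Z * X).trace) * ψ (Z * W).trace := by
          simp only [Finset.mul_sum, Finset.sum_mul]
          rw [Finset.sum_comm]
          refine Finset.sum_congr rfl fun X _ => Finset.sum_congr rfl fun Z _ => by ring
      _ = _ := by
          simp only [key, hW, mul_ite, mul_zero, Finset.sum_ite_eq', Finset.mem_univ, if_true]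
          field_simp

theorem eq_zero_of_charTrace_convMul {ψ : AddChar F k} (hψ : ψ.IsPrimitive)
    (hq : (Fintype.card F : k) ≠ 0) {y : MatSpace k F n m}
    (hy : ∀ c : MatSpace k F m n, charTrace ψ (convMul y c) = 0) : y = 0 := by
  ext D
  obtain ⟨q, hq⟩ := exists_charTrace_eq hψ hq (Finsupp.lapply D : MatSpace k F n m →ₗ[k] k)
  have := hq y
  rw [charTrace_convMul_comm, hy] at this
  simpa using this.symm

/-- The scalar functional `charTrace ψ ∘ h` already determines `h`: right-linearity lets one test `h
x` against every `c`, and the pairing is nondegenerate. -/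
theorem exists_eq_convMul {ψ : AddChar F k} (hψ : ψ.IsPrimitive)
    (hq : (Fintype.card F : k) ≠ 0) (h : MatSpace k F n m →ₗ[k] MatSpace k F m m)
    (hh : ∀ x b, h (convMul x b) = convMul (h x) b) :
    ∃ q : MatSpace k F m n, ∀ x, h x = convMul q x := by
  obtain ⟨q, hq'⟩ := exists_charTrace_eq hψ hq (charTrace ψ ∘ₗ h)
  refine ⟨q, fun x => (sub_eq_zero.1 (eq_zero_of_charTrace_convMul hψ hq fun c => ?_))⟩
  rw [map_sub, LinearMap.sub_apply, map_sub, convMul_assoc, hq', LinearMap.comp_apply, hh, sub_self]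

end Fourier

/-! ### Left identities for the span of matrices of bounded rank -/

section LeftIdentity

variable (k F : Type*) [Field k] [Field F]

/-- The span of the `n × n` matrices of rank at most `m` has a left identity
for its action on `k[𝔐_{n,m}]`. -/
def HasLeftIdentity (n m : ℕ) : Prop :=
  ∃ ε ∈ rankLE k F n n m, ∀ x : MatSpace k F n m, convMul ε x = x

variable {k F} {n m l r : ℕ}

theorem convMul_eq_self {ε : MatSpace k F n n} (hε : ∀ x : MatSpace k F n m, convMul ε x = x)
    {x : MatSpace k F n l} (hx : x ∈ rankLE k F n l m) : convMul ε x = x := by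
  refine rankLE_induction (P := fun x => convMul ε x = x)
    (fun A a hA => ?_) (fun x x' hx hx' => ?_) hx
  · obtain ⟨Y, Z, rfl⟩ := exists_eq_mul_of_rank_le A hA
    have : (Finsupp.single (Y * Z) a : MatSpace k F n l) =
        convMul (Finsupp.single Y 1) (Finsupp.single Z a) := by
      rw [single_convMul_single, one_mul]
    rw [this, ← convMul_assoc, hε]
  · rw [map_add, hx, hx']

/-- The transpose of a left identity is a right identity, so the two coincide. -/
theorem HasLeftIdentity.exists_central (h : HasLeftIdentity k F n r) :
    ∃ e ∈ rankLE k F n n r,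
      (∀ (l : ℕ), ∀ x ∈ rankLE k F l n r, convMul x e = x) ∧
      ∀ b, convMul e b = convMul b e := by
  obtain ⟨e, he, hl⟩ := h
  have hl' : ∀ (l : ℕ), ∀ x ∈ rankLE k F n l r, convMul e x = x :=
    fun l x hx => convMul_eq_self hl hx
  have hr : ∀ (l : ℕ), ∀ x ∈ rankLE k F l n r, convMul x (transpose e) = x := fun l x hx => by
    have := hl' l _ (transpose_mem_rankLE hx)
    rw [← transpose_transpose (convMul x (transpose e)), transpose_convMul, transpose_transpose,
      this, transpose_transpose]
  have hee : transpose e = e :=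
    (hl' n _ (transpose_mem_rankLE he)).symm.trans (hr n e he)
  rw [hee] at hr
  refine ⟨e, he, hr, fun b => ?_⟩
  -- Both sides equal `e b e`.
  rw [← hr n _ (convMul_mem_rankLE_of_left he b), convMul_assoc,
    hl' n _ (convMul_mem_rankLE_of_right b he)]

/-- Two matrices are equivalent if they differ by an invertible column operation. -/
def columnSetoid (F : Type*) [Field F] (n m : ℕ) : Setoid (Matrix (Fin n) (Fin m) F) where
  r X Y := ∃ g : Matrix (Fin m) (Fin m) F, IsUnit g ∧ Y = X * g
  iseqv :=
    { refl := fun X => ⟨1, isUnit_one, by simp⟩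
      symm := by
        rintro X _ ⟨_, ⟨g, rfl⟩, rfl⟩
        exact ⟨_, (g⁻¹).isUnit, by rw [Matrix.mul_assoc, Units.mul_inv, Matrix.mul_one]⟩
      trans := by
        rintro X _ _ ⟨g, hg, rfl⟩ ⟨h, hh, rfl⟩
        exact ⟨_, hg.mul hh, by rw [Matrix.mul_assoc]⟩ }

/-- For a full-rank representative `X₀` of a class of matrices and a central idempotent `e`
absorbing the matrices of smaller rank, `[X₀ g] ↦ [g] (1 - e)` extends by zero to a
morphism of right modules. -/
theorem exists_coordinate {e : MatSpace k F (m + 1) (m + 1)}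
    (hr : ∀ x ∈ rankLE k F (m + 1) (m + 1) m, convMul x e = x)
    (hc : ∀ b, convMul e b = convMul b e) (X₀ : Matrix (Fin n) (Fin (m + 1)) F)
    (hX₀ : m + 1 ≤ X₀.rank) :
    ∃ h : MatSpace k F n (m + 1) →ₗ[k] MatSpace k F (m + 1) (m + 1),
      (∀ x b, h (convMul x b) = convMul (h x) b) ∧
      (∀ g, h (Finsupp.single (X₀ * g) 1) =
        Finsupp.single g 1 - convMul (Finsupp.single g 1) e) ∧
      ∀ X, (∀ g : Matrix (Fin (m + 1)) (Fin (m + 1)) F, IsUnit g → X ≠ X₀ * g) → h (Finsupp.single X 1) = 0 := by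
  classical
  let d : Matrix (Fin (m + 1)) (Fin (m + 1)) F → MatSpace k F (m + 1) (m + 1) :=
    fun g => Finsupp.single g 1 - convMul (Finsupp.single g 1) e
  -- A singular `g` has rank at most `m`, so `e` absorbs it; this is why the formula on `X₀ g` holds
  -- for all `g`.
  have hd0 : ∀ g, ¬ IsUnit g → d g = 0 := fun g hg => by
    refine sub_eq_zero.2 (hr _ (single_mem_rankLE ?_ _)).symm
    by_contra hlt
    exact hg (isUnit_of_le_rank (by omega))
  have hdmul : ∀ g b, convMul (d g) (Finsupp.single b 1) = d (g * b) := fun g b => by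
    simp only [d, map_sub, LinearMap.sub_apply, convMul_assoc, hc, single_convMul_single, one_mul]
    rw [← convMul_assoc, single_convMul_single, one_mul]
  let c : Matrix (Fin n) (Fin (m + 1)) F → MatSpace k F (m + 1) (m + 1) := fun X =>
    if hX : ∃ g : Matrix (Fin (m + 1)) (Fin (m + 1)) F, IsUnit g ∧ X = X₀ * g then d hX.choose else 0
  have hc1 : ∀ g, c (X₀ * g) = d g := fun g => by
    by_cases hX : ∃ g' : Matrix (Fin (m + 1)) (Fin (m + 1)) F, IsUnit g' ∧ X₀ * g = X₀ * g'
    · have := mul_left_cancel_of_le_rank hX₀ hX.choose_spec.2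
      simp only [c, dif_pos hX]
      rw [← this]
    · simp only [c, dif_neg hX]
      exact (hd0 g fun hg => hX ⟨g, hg, rfl⟩).symm
  have hc0 : ∀ X, (∀ g : Matrix (Fin (m + 1)) (Fin (m + 1)) F, IsUnit g → X ≠ X₀ * g) → c X = 0 := fun X hX => by
    have : ¬ ∃ g : Matrix (Fin (m + 1)) (Fin (m + 1)) F, IsUnit g ∧ X = X₀ * g := fun ⟨g, hg, h⟩ => hX g hg h
    simp only [c, dif_neg this]
  have hcmul : ∀ X b, c (X * b) = convMul (c X) (Finsupp.single b 1) := fun X b => by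
    by_cases hX : ∃ g : Matrix (Fin (m + 1)) (Fin (m + 1)) F, IsUnit g ∧ X = X₀ * g
    · obtain ⟨g, hg, rfl⟩ := hX
      rw [hc1, hdmul, Matrix.mul_assoc, hc1]
    · push Not at hX
      rw [hc0 X hX, hc0, map_zero, LinearMap.zero_apply]
      rintro g hg h
      -- If `X b` is in the full-rank class of `X₀`, then `b` has full rank and `X` was already in
      -- that class.
      have hb : IsUnit b := by
        refine isUnit_of_le_rank ?_
        have h1 := Matrix.rank_mul_le_right X b
        have h2 : (X₀ * g).rank = X₀.rank :=
          Matrix.rank_mul_eq_left_of_isUnit_det g X₀ ((Matrix.isUnit_iff_isUnit_det g).1 hg)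
        rw [h, h2] at h1
        omega
      obtain ⟨b, rfl⟩ := hb
      refine hX (g * ↑b⁻¹) (hg.mul b⁻¹.isUnit) ?_
      rw [← Matrix.mul_assoc, ← h, Matrix.mul_assoc, Units.mul_inv, Matrix.mul_one]
  refine ⟨Finsupp.linearCombination k c, fun x b => ?_, fun g => ?_, fun X hX => ?_⟩
  · induction x using Finsupp.induction_linear with
    | zero => simp
    | add x x' hx hx' => simp [hx, hx']
    | single X a =>
      induction b using Finsupp.induction_linear with
      | zero => simp
      | add y y' hy hy' => rw [map_add, map_add, hy, hy', map_add]
      | single b t =>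
        have : (Finsupp.single b t : MatSpace k F (m + 1) (m + 1)) = t • Finsupp.single b 1 := by
          simp
        rw [single_convMul_single, Finsupp.linearCombination_single,
          Finsupp.linearCombination_single, hcmul, this]
        simp only [map_smul, LinearMap.smul_apply, smul_smul, mul_comm]
  · rw [Finsupp.linearCombination_single, one_smul, hc1]
  · rw [Finsupp.linearCombination_single, one_smul, hc0 X hX]

theorem hasLeftIdentity_of_isPrimitive [Fintype F] {ψ : AddChar F k} (hψ : ψ.IsPrimitive)
    (hq : (Fintype.card F : k) ≠ 0) (n m : ℕ) : HasLeftIdentity k F n m := by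
  classical
  induction m generalizing n with
  | zero =>
    refine ⟨Finsupp.single 0 1, single_mem_rankLE (by simp) _, fun x => ?_⟩
    induction x using Finsupp.induction_linear with
    | zero => simp
    | add x x' hx hx' => rw [map_add, hx, hx']
    | single X a =>
      rw [single_convMul_single, one_mul]
      congr 1
      ext i j
      exact j.elim0
  | succ m ih =>
    -- The induction hypothesis is used at two sizes: `m + 1` for the central `e`, and `n` for `ε`.
    obtain ⟨e, he, hr, hc⟩ := (ih (m + 1)).exists_central
    obtain ⟨ε, hε, hεl⟩ := ih n
    suffices ∃ u ∈ rankLE k F n n (m + 1), ∀ x : MatSpace k F n (m + 1),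
        convMul u x = x - convMul x e by
      obtain ⟨u, hu, hux⟩ := this
      -- This is `1 - (1 - ε)(1 - u)`: `1 - u` sends `x` to `x e`, of lower rank, which `1 - ε`
      -- kills.
      refine ⟨u + (ε - convMul ε u), add_mem hu (sub_mem (rankLE_mono (Nat.le_succ m) hε)
        (convMul_mem_rankLE_of_right ε hu)), fun x => ?_⟩
      have : convMul ε (convMul x e) = convMul x e :=
        convMul_eq_self hεl (convMul_mem_rankLE_of_right x he)
      simp only [map_add, map_sub, LinearMap.add_apply, LinearMap.sub_apply, convMul_assoc, hux,
        this]
      abel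
    let S := columnSetoid F n (m + 1)
    have : Fintype (Quotient S) := Fintype.ofFinite _
    have hex : ∀ i : Quotient S, ∃ q : MatSpace k F (m + 1) n, m + 1 ≤ i.out.rank →
        (∀ g, convMul q (Finsupp.single (i.out * g) 1) =
          Finsupp.single g 1 - convMul (Finsupp.single g 1) e) ∧
        ∀ X, (∀ g : Matrix (Fin (m + 1)) (Fin (m + 1)) F, IsUnit g → X ≠ i.out * g) → convMul q (Finsupp.single X 1) = 0 := by
      intro i
      by_cases hi : m + 1 ≤ i.out.rank
      · obtain ⟨h, hh, h1, h0⟩ := exists_coordinate (hr (m + 1)) hc i.out hi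
        obtain ⟨q, hq⟩ := exists_eq_convMul hψ hq h hh
        simp only [hq] at h1 h0
        exact ⟨q, fun _ => ⟨h1, h0⟩⟩
      · exact ⟨0, fun h => absurd h hi⟩
    choose q hq' using hex
    -- Coordinates times representatives: on `X = X₀ g` only the class of `X` contributes, giving
    -- `X₀ g (1 - e)`.
    refine ⟨∑ i : Quotient S with m + 1 ≤ i.out.rank, convMul (Finsupp.single i.out 1) (q i),
      sum_mem fun i _ => convMul_mem_rankLE_of_left
        (single_mem_rankLE ((Matrix.rank_le_width _)) _) _, fun x => ?_⟩
    induction x using Finsupp.induction_linear with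
    | zero => simp
    | add x x' hx hx' =>
      rw [map_add, hx, hx', map_add, LinearMap.add_apply]
      abel
    | single X a =>
      have hXa : (Finsupp.single X a : MatSpace k F n (m + 1)) = a • Finsupp.single X 1 := by simp
      rw [hXa, map_smul, map_smul, LinearMap.smul_apply, ← smul_sub]
      congr 1
      simp only [map_sum, LinearMap.sum_apply, convMul_assoc]
      have hrank : ∀ i : Quotient S, ∀ g : Matrix (Fin (m + 1)) (Fin (m + 1)) F, IsUnit g → X = i.out * g → X.rank = i.out.rank := by
        rintro i g hg rfl
        exact Matrix.rank_mul_eq_left_of_isUnit_det g _ ((Matrix.isUnit_iff_isUnit_det g).1 hg)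
      obtain ⟨g, hg, hXg⟩ : ∃ g : Matrix (Fin (m + 1)) (Fin (m + 1)) F, IsUnit g ∧ X = (⟦X⟧ : Quotient S).out * g :=
        Quotient.mk_out (s := S) X
      by_cases hX : m + 1 ≤ X.rank
      · rw [Finset.sum_eq_single_of_mem (⟦X⟧ : Quotient S)]
        · have h1 := (hq' ⟦X⟧ (by rwa [← hrank _ g hg hXg])).1 g
          rw [← hXg] at h1
          rw [h1, map_sub, ← convMul_assoc, single_convMul_single, ← hXg, one_mul]
        · simpa [← hrank _ g hg hXg] using hX
        · intro i hi hne
          rw [(hq' i (by simpa using hi)).2 X, map_zero]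
          rintro g hg h
          refine hne ?_
          rw [← i.out_eq]
          exact Quotient.sound (s := S) ⟨g, hg, h⟩
      -- In lower rank, `e` fixes `X` and every coordinate of `X` vanishes.
      · rw [hr n _ (single_mem_rankLE (by omega) _), sub_self]
        refine Finset.sum_eq_zero fun i hi => ?_
        have hi : m + 1 ≤ i.out.rank := by simpa using hi
        rw [(hq' i hi).2 X, map_zero]
        rintro g hg h
        exact hX (by rwa [hrank i g hg h])

/-- The condition on `ε` is linear with coefficients in `k`, so a `k`-linear retraction `K → k`
applied to the coefficients of `ε` preserves it. -/
theorem HasLeftIdentity.of_algebra (K : Type*) [Field K] [Algebra k K]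
    (h : HasLeftIdentity K F n m) : HasLeftIdentity k F n m := by
  obtain ⟨ε, hε, hεx⟩ := h
  obtain ⟨φ, hφ⟩ : ∃ φ : K →ₗ[k] k, φ 1 = 1 := by
    obtain ⟨φ, hφ⟩ := (Algebra.linearMap k K).exists_leftInverse_of_injective
      (LinearMap.ker_eq_bot.2 (algebraMap k K).injective)
    exact ⟨φ, by simpa using LinearMap.congr_fun hφ 1⟩
  have hmap : ∀ (y : MatSpace K F n n) (X : Matrix (Fin n) (Fin m) F),
      Finsupp.mapRange.linearMap φ (convMul y (Finsupp.single X 1)) =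
        convMul (Finsupp.mapRange.linearMap φ y) (Finsupp.single X 1) := fun y X => by
    induction y using Finsupp.induction_linear with
    | zero => simp
    | add y y' hy hy' => simp only [map_add, LinearMap.add_apply, hy, hy']
    | single Y a => simp
  refine ⟨Finsupp.mapRange.linearMap φ ε, fun A hA => hε ?_, fun x => ?_⟩
  · exact Finsupp.support_mapRange (hf := map_zero φ) hA
  · induction x using Finsupp.induction_linear with
    | zero => simp
    | add x x' hx hx' => rw [map_add, hx, hx']
    | single X a =>
      have : (Finsupp.single X a : MatSpace k F n m) = a • Finsupp.single X 1 := by simp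
      rw [this, map_smul, ← hmap, hεx]
      simp [hφ]

theorem hasLeftIdentity [Fintype F] (hq : (Fintype.card F : k) ≠ 0) (n m : ℕ) :
    HasLeftIdentity k F n m := by
  have hchar : ringChar k ≠ ringChar F := fun h => hq <| by
    rw [ringChar.spec, h, ← ringChar.spec]
    exact Nat.cast_card_eq_zero F
  let ψ := AddChar.FiniteField.primitiveChar F k hchar
  refine HasLeftIdentity.of_algebra (CyclotomicField ψ.n k)
    (hasLeftIdentity_of_isPrimitive ψ.prim ?_ n m)
  rw [← map_natCast (algebraMap k (CyclotomicField ψ.n k))]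
  exact (map_ne_zero _).2 hq

end LeftIdentity

/-! ### From left identities to the double centralizer -/

section Centralizer

variable {k F : Type*} [Field k] [Field F] {n m : ℕ}

theorem leftAction_single (A : Matrix (Fin n) (Fin n) F) (a : k) (x : MatSpace k F n m) :
    leftAction k F n m (MonoidAlgebra.single A a) x = convMul (Finsupp.single A a) x := by
  induction x using Finsupp.induction_linear with
  | zero => simp
  | add x x' hx hx' => rw [map_add, map_add, hx, hx']
  | single X b => simp [leftAction, -Finsupp.single_mul]

theorem leftAction_apply (a : MatAlg k F n) (x : MatSpace k F n m) :
    leftAction k F n m a x = convMul a.coeff x := by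
  induction a using MonoidAlgebra.induction_linear with
  | zero => simp
  | add a a' ha ha' => simp [ha, ha']
  | single A a => rw [leftAction_single, MonoidAlgebra.coeff_single]

theorem rightAction_apply (b : MatAlg k F m) (x : MatSpace k F n m) :
    rightAction k F n m (MulOpposite.op b) x = convMul x b.coeff := by
  induction b using MonoidAlgebra.induction_linear with
  | zero => simp
  | add b b' hb hb' => simp [hb, hb']
  | single B b =>
    rw [MonoidAlgebra.coeff_single]
    induction x using Finsupp.induction_linear with
    | zero => simp
    | add x x' hx hx' => rw [map_add, map_add, hx, hx', LinearMap.add_apply]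
    | single X a => simp [rightAction, -Finsupp.single_mul, mul_comm]

theorem mem_range_leftAction {f : Module.End k (MatSpace k F n m)} :
    f ∈ (leftAction k F n m).range ↔ ∃ a : MatSpace k F n n, ∀ x, f x = convMul a x := by
  constructor
  · rintro ⟨a, rfl⟩
    exact ⟨a.coeff, leftAction_apply a⟩
  · rintro ⟨a, ha⟩
    exact ⟨.ofCoeff a, LinearMap.ext fun x => by
      exact (leftAction_apply _ x).trans (ha x).symm⟩

theorem mem_range_rightAction {f : Module.End k (MatSpace k F n m)} :
    f ∈ (rightAction k F n m).range ↔ ∃ b : MatSpace k F m m, ∀ x, f x = convMul x b := by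
  constructor
  · rintro ⟨b, rfl⟩
    exact ⟨b.unop.coeff, rightAction_apply b.unop⟩
  · rintro ⟨b, hb⟩
    exact ⟨MulOpposite.op (.ofCoeff b), LinearMap.ext fun x => by
      exact (rightAction_apply _ x).trans (hb x).symm⟩

theorem mem_centralizer_leftAction {f : Module.End k (MatSpace k F n m)} :
    f ∈ Subalgebra.centralizer k
        ((leftAction k F n m).range : Set (Module.End k (MatSpace k F n m))) ↔
      ∀ a x, f (convMul a x) = convMul a (f x) := by
  rw [Subalgebra.mem_centralizer_iff]
  constructor
  · intro h a x
    have := LinearMap.congr_fun (h _ ⟨.ofCoeff a, rfl⟩) x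
    simp only [Module.End.mul_apply] at this
    erw [leftAction_apply, leftAction_apply] at this
    exact this.symm
  · rintro h _ ⟨a, rfl⟩
    refine LinearMap.ext fun x => ?_
    exact ((leftAction_apply _ _).trans (h _ _).symm).trans
      (congrArg f (leftAction_apply a x).symm)

theorem mem_centralizer_rightAction {f : Module.End k (MatSpace k F n m)} :
    f ∈ Subalgebra.centralizer k
        ((rightAction k F n m).range : Set (Module.End k (MatSpace k F n m))) ↔
      ∀ x b, f (convMul x b) = convMul (f x) b := by
  rw [Subalgebra.mem_centralizer_iff]
  constructor
  · intro h x b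
    have := LinearMap.congr_fun (h _ ⟨MulOpposite.op (.ofCoeff b), rfl⟩) x
    simp only [Module.End.mul_apply] at this
    erw [rightAction_apply, rightAction_apply] at this
    exact this.symm
  · rintro h _ ⟨b, rfl⟩
    refine LinearMap.ext fun x => ?_
    exact ((rightAction_apply b.unop _).trans (h _ _).symm).trans
      (congrArg f (rightAction_apply b.unop x).symm)

theorem HasLeftIdentity.exists_eq_convMul (h : HasLeftIdentity k F n m)
    (f : Module.End k (MatSpace k F n m)) (hf : ∀ x b, f (convMul x b) = convMul (f x) b) :
    ∃ a : MatSpace k F n n, ∀ x, f x = convMul a x := by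
  obtain ⟨ε, hε, hεx⟩ := h
  suffices ∃ a : MatSpace k F n n, ∀ x, f (convMul ε x) = convMul a x by
    simpa only [hεx] using this
  refine rankLE_induction (P := fun ε => ∃ a : MatSpace k F n n, ∀ x, f (convMul ε x) = convMul a x)
    (fun A t hA => ?_) ?_ hε
  · obtain ⟨Y, Z, rfl⟩ := exists_eq_mul_of_rank_le A hA
    refine ⟨convMul (f (Finsupp.single Y 1)) (Finsupp.single Z t), fun x => ?_⟩
    -- `Z x` lies in `k[𝔐_m]`, so it can be moved through `f`.
    rw [convMul_assoc, ← hf, ← convMul_assoc, single_convMul_single, one_mul]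
  · rintro ε ε' ⟨a, ha⟩ ⟨a', ha'⟩
    exact ⟨a + a', fun x => by simp only [map_add, LinearMap.add_apply, ha, ha']⟩

/-- Conjugation by transposition swaps the two actions, and with them `n` and `m`. -/
theorem HasLeftIdentity.exists_eq_convMul_right (h : HasLeftIdentity k F m n)
    (f : Module.End k (MatSpace k F n m)) (hf : ∀ a x, f (convMul a x) = convMul a (f x)) :
    ∃ b : MatSpace k F m m, ∀ x, f x = convMul x b := by
  obtain ⟨a, ha⟩ := h.exists_eq_convMul (transpose ∘ₗ f ∘ₗ transpose) fun x b => by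
    simp only [LinearMap.comp_apply, transpose_convMul, hf, transpose_transpose]
  refine ⟨transpose a, fun x => ?_⟩
  have := ha (transpose x)
  simp only [LinearMap.comp_apply, transpose_transpose] at this
  rw [← transpose_transpose (f x), this, transpose_convMul, transpose_transpose]

theorem centralizer_range_leftAction (h : HasLeftIdentity k F m n) :
    Subalgebra.centralizer k
        ((leftAction k F n m).range : Set (Module.End k (MatSpace k F n m))) =
      (rightAction k F n m).range := by
  ext f
  rw [mem_centralizer_leftAction, mem_range_rightAction]
  exact ⟨h.exists_eq_convMul_right f, fun ⟨b, hb⟩ a x => by rw [hb, hb, convMul_assoc]⟩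

theorem centralizer_range_rightAction (h : HasLeftIdentity k F n m) :
    Subalgebra.centralizer k
        ((rightAction k F n m).range : Set (Module.End k (MatSpace k F n m))) =
      (leftAction k F n m).range := by
  ext f
  rw [mem_centralizer_rightAction, mem_range_leftAction]
  exact ⟨h.exists_eq_convMul f, fun ⟨a, ha⟩ x b => by rw [ha, ha, convMul_assoc]⟩

end Centralizer

/-! ### Tensor powers as spaces of matrices -/

section Tensor

variable (k F : Type*) [Field k] [Field F] (n m : ℕ)

/-- The isomorphism `V^{⊗ m} ≅ k[𝔐_{n,m}]` assembling vectors into the columns of a matrix. -/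
def tensorEquiv : (⨂[k] _ : Fin m, VecSpace k F n) ≃ₗ[k] MatSpace k F n m :=
  (Basis.piTensorProduct fun _ : Fin m =>
      (Finsupp.basisSingleOne : Module.Basis (Fin n → F) k (VecSpace k F n))).repr ≪≫ₗ
    Finsupp.domLCongr ((Equiv.piComm fun _ _ => F).trans Matrix.of)

variable {k F n m}

omit [Field F] in
theorem tensorEquiv_tprod_single (v : Fin m → Fin n → F) :
    tensorEquiv k F n m (PiTensorProduct.tprod k fun j => Finsupp.single (v j) (1 : k)) =
      Finsupp.single (Matrix.of fun i j => v j i) 1 := by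
  have h : PiTensorProduct.tprod k (fun j => Finsupp.single (v j) (1 : k)) =
      Basis.piTensorProduct (fun _ : Fin m =>
        (Finsupp.basisSingleOne : Module.Basis (Fin n → F) k (VecSpace k F n))) v := by
    simp
  rw [tensorEquiv, LinearEquiv.trans_apply, h, Module.Basis.repr_self, Finsupp.domLCongr_single]
  rfl

theorem tensorEquiv_tensorAction (a : MatAlg k F n) (t : ⨂[k] _ : Fin m, VecSpace k F n) :
    tensorEquiv k F n m (tensorAction k F n m a t) =
      leftAction k F n m a (tensorEquiv k F n m t) := by
  induction a using MonoidAlgebra.induction_linear with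
  | zero => simp
  | add a a' ha ha' => simp only [map_add, LinearMap.add_apply, ha, ha']
  | single A c =>
    refine LinearMap.congr_fun (f := (tensorEquiv k F n m).toLinearMap ∘ₗ
      tensorAction k F n m (MonoidAlgebra.single A c))
      (g := leftAction k F n m (MonoidAlgebra.single A c) ∘ₗ (tensorEquiv k F n m).toLinearMap)
      ?_ t
    refine (Basis.piTensorProduct fun _ : Fin m =>
      (Finsupp.basisSingleOne : Module.Basis (Fin n → F) k (VecSpace k F n))).ext fun v => ?_
    simp only [Basis.piTensorProduct_apply, Finsupp.coe_basisSingleOne, LinearMap.comp_apply,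
      LinearEquiv.coe_coe, tensorEquiv_tprod_single, leftAction_single, single_convMul_single]
    simp only [tensorAction, MonoidAlgebra.lift_single, MonoidHom.coe_mk, OneHom.coe_mk,
      LinearMap.smul_apply, PiTensorProduct.map_tprod, Finsupp.lmapDomain_apply,
      Finsupp.mapDomain_single, map_smul, tensorEquiv_tprod_single, Finsupp.smul_single,
      smul_eq_mul]
    rfl

end Tensor

end MatrixMonoid

end

theorem theorem6p1 (k F : Type*) [Field k] [Field F] [Fintype F]
    (hq : (Fintype.card F : k) ≠ 0) (n m : ℕ) :
    (∃ Φ : (⨂[k] _ : Fin m, MatrixMonoid.VecSpace k F n) ≃ₗ[k] MatrixMonoid.MatSpace k F n m,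
      (∀ v : Fin m → Fin n → F,
        Φ (PiTensorProduct.tprod k fun j => Finsupp.single (v j) (1 : k)) =
          Finsupp.single (Matrix.of fun i j => v j i) 1) ∧
      ∀ (a : MatrixMonoid.MatAlg k F n) (t : ⨂[k] _ : Fin m, MatrixMonoid.VecSpace k F n),
        Φ (MatrixMonoid.tensorAction k F n m a t) =
          MatrixMonoid.leftAction k F n m a (Φ t)) ∧
    Subalgebra.centralizer k
        ((MatrixMonoid.leftAction k F n m).range :
          Set (Module.End k (MatrixMonoid.MatSpace k F n m))) =
      (MatrixMonoid.rightAction k F n m).range ∧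
    Subalgebra.centralizer k
        ((MatrixMonoid.rightAction k F n m).range :
          Set (Module.End k (MatrixMonoid.MatSpace k F n m))) =
      (MatrixMonoid.leftAction k F n m).range :=
  ⟨⟨MatrixMonoid.tensorEquiv k F n m, MatrixMonoid.tensorEquiv_tprod_single,
    MatrixMonoid.tensorEquiv_tensorAction⟩,
    MatrixMonoid.centralizer_range_leftAction (MatrixMonoid.hasLeftIdentity hq m n),
    MatrixMonoid.centralizer_range_rightAction (MatrixMonoid.hasLeftIdentity hq n m)⟩
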